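/- For $F\in\{\mathbb R,\mathbb C,\mathbb H\}$ and $n\ge 2$ let $P^n(F)$ be the projective space of lines through the origin of $F^{n+1}$, with the geodesic distance normalized to have diameter $2\pi$, that is, $|pq|=4\arccos\frac{|\langle x,y\rangle|}{\|x\|\,\|y\|}$ for $p=Fx$, $q=Fy$. We say that $f\colon[-1,1]\to\mathbb R$ is the isotropic part of a positive definite kernel on $P^\infty$ if $$f(t)=\sum_{k=0}^\infty a_k(f)\Big(\frac{1+t}{2}\Big)^k,\qquad t\in[-1,1],$$ with all $a_k(f)\ge 0$ and the series convergent at $t=1$. We say that such an $f$ is the isotropic part of a strictly positive definite kernel on $P^\infty$ (over $F$) if, for every $n\ge 2$, the kernel $K(p,q)=f(\cos(|pq|/2))$ on $P^n(F)$ is strictly positive definite, i.e. $\sum_{i,j=1}^m c_ic_jK(p_i,p_j)>0$ for all $m\ge1$, all distinct $p_1,\dots,p_m\in P^n(F)$ and all $(c_1,\dots,c_m)\in\mathbb R^m\setminus\{0\}$. **Theorem 3.3 (product on $P^\infty$).** Let $f$ and $g$ be isotropic parts of positive definite kernels on $P^\infty$, neither of them identically zero on $[-1,1]$. Then, for each $F\in\{\mathbb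 R,\mathbb C,\mathbb H\}$, the following assertions are equivalent: 1. $fg$ is the isotropic part of a strictly positive definite kernel on $P^\infty$ over $F$; 2. $f$ or $g$ is the isotropic part of a strictly positive definite kernel on $P^\infty$ over $F$; 3. $f$ or $g$ is not a polynomial, i.e. at least one of them is not the restriction to $[-1,1]$ of a real polynomial. -/

import Mathlib

open scoped Quaternion LinearAlgebra.Projectivization

noncomputable section

namespace PInfty

section Geometry

variable {F : Type} [NormedDivisionRing F] [StarRing F] {n : ℕ}

/-- The standard sesquilinear form `∑ xᵢ ȳᵢ` on the left vector space `F ^ (n + 1)`. -/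
def herm (x y : Fin (n + 1) → F) : F := ∑ i, x i * star (y i)

/-- The Euclidean (Hermitian) norm on `F ^ (n + 1)`. -/
def enorm2 (x : Fin (n + 1) → F) : ℝ := Real.sqrt (∑ i, ‖x i‖ ^ 2)

variable (F n) in
/-- The projective space `Pⁿ(F)` of lines through the origin of the (left) vector space
`F ^ (n + 1)`; here `n` is the dimension over `F`. -/
abbrev ProjSpace : Type := ℙ F (Fin (n + 1) → F)

/-- The cosine `|⟨x, y⟩| / (‖x‖ ‖y‖)` of the angle between the lines `p = F x` and `q = F y`.
It does not depend on the representatives, see `lineCos_mk`. -/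
def lineCos (p q : ProjSpace F n) : ℝ :=
  ‖herm p.rep q.rep‖ / (enorm2 p.rep * enorm2 q.rep)

/-- The geodesic distance on `Pⁿ(F)`, normalized so that the diameter is `2π`: it is four times
the angle (between `0` and `π / 2`) of the two lines. -/
def geoDist (p q : ProjSpace F n) : ℝ := 4 * Real.arccos (lineCos p q)

theorem herm_smul_smul (a b : F) (x y : Fin (n + 1) → F) :
    herm (a • x) (b • y) = a * herm x y * star b := by
  simp [herm, Finset.mul_sum, Finset.sum_mul, mul_assoc]

theorem enorm2_smul {E : Type} [NormedDivisionRing E] {m : ℕ} (a : E) (x : Fin (m + 1) → E) :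
    enorm2 (a • x) = ‖a‖ * enorm2 x := by
  have h : ∑ i, ‖(a • x) i‖ ^ 2 = ‖a‖ ^ 2 * ∑ i, ‖x i‖ ^ 2 := by
    simp [Finset.mul_sum, mul_pow]
  rw [enorm2, enorm2, h, Real.sqrt_mul (by positivity), Real.sqrt_sq (norm_nonneg a)]

theorem lineCos_mk [NormedStarGroup F] (x y : Fin (n + 1) → F) (hx : x ≠ 0) (hy : y ≠ 0) :
    lineCos (Projectivization.mk F x hx) (Projectivization.mk F y hy) =
      ‖herm x y‖ / (enorm2 x * enorm2 y) := by
  obtain ⟨a, ha⟩ := Projectivization.exists_smul_eq_mk_rep F x hx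
  obtain ⟨b, hb⟩ := Projectivization.exists_smul_eq_mk_rep F y hy
  have h1 : ‖(a : F)‖ ≠ 0 := by simp
  have h2 : ‖(b : F)‖ ≠ 0 := by simp
  rw [lineCos, ← ha, ← hb, Units.smul_def, Units.smul_def, herm_smul_smul, enorm2_smul,
    enorm2_smul, norm_mul, norm_mul, norm_star,
    show ‖(a : F)‖ * enorm2 x * (‖(b : F)‖ * enorm2 y)
      = (‖(a : F)‖ * ‖(b : F)‖) * (enorm2 x * enorm2 y) by ring,
    show ‖(a : F)‖ * ‖herm x y‖ * ‖(b : F)‖ = (‖(a : F)‖ * ‖(b : F)‖) * ‖herm x y‖ by ring,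
    mul_div_mul_left _ _ (mul_ne_zero h1 h2)]

/-- The isotropic kernel `K(p, q) = f (cos (|pq| / 2))` on `Pⁿ(F)` with isotropic part `f`. -/
def kernel (f : Set.Icc (-1 : ℝ) 1 → ℝ) (p q : ProjSpace F n) : ℝ :=
  f ⟨Real.cos (geoDist p q / 2), Real.cos_mem_Icc _⟩

end Geometry

/-- A real kernel is strictly positive definite on `X` if its quadratic forms at finitely many
distinct points are positive at nonzero real vectors. -/
def StrictlyPosDef {X : Type} (K : X → X → ℝ) : Prop :=
  ∀ (m : ℕ) (x : Fin m → X), Function.Injective x → ∀ c : Fin m → ℝ, c ≠ 0 →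
    0 < ∑ i, ∑ j, c i * c j * K (x i) (x j)

/-- `f` is the isotropic part of a positive definite kernel on `P^∞`:
`f(t) = ∑ aₖ ((1 + t) / 2) ^ k` on `[-1, 1]` with nonnegative coefficients
(the series converges at every point of `[-1, 1]`, `t = 1` included). -/
def IsPD (f : Set.Icc (-1 : ℝ) 1 → ℝ) : Prop :=
  ∃ a : ℕ → ℝ, (∀ k, 0 ≤ a k) ∧
    ∀ t : Set.Icc (-1 : ℝ) 1, HasSum (fun k : ℕ => a k * ((1 + (t : ℝ)) / 2) ^ k) (f t)

/-- `f` is the isotropic part of a strictly positive definite kernel on `P^∞`, the latter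
understood as the increasing family of the projective spaces `Pⁿ(F)`, `n ≥ 2`. -/
def IsSPD (F : Type) [NormedDivisionRing F] [StarRing F] (f : Set.Icc (-1 : ℝ) 1 → ℝ) : Prop :=
  IsPD f ∧ ∀ n : ℕ, 2 ≤ n → StrictlyPosDef (kernel f : ProjSpace F n → ProjSpace F n → ℝ)

/-- `f` is (the restriction to `[-1, 1]` of) a real polynomial. -/
def IsPoly (f : Set.Icc (-1 : ℝ) 1 → ℝ) : Prop :=
  ∃ p : Polynomial ℝ, ∀ t : Set.Icc (-1 : ℝ) 1, f t = p.eval (t : ℝ)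

end PInfty

end

namespace PInfty

open Filter Topology

/-! Since `(1 + cos (|pq| / 2)) / 2 = lineCos p q ^ 2`, the kernel is `∑ aₖ lineCos ^ (2k)`. Each
power is positive semidefinite, and at distinct points its matrix tends to the identity as `k → ∞`;
so infinitely many `aₖ > 0` force strictness (`strictlyPosDef_kernel`). A polynomial isotropic part
gives degenerate matrices at enough points of one projective line (`not_strictlyPosDef_of_isPoly`).
Hence strict means non-polynomial, and for products it remains to inspect the Cauchy product of the
coefficients. `AdjointMul` is what allows one argument for ℝ, ℂ and ℍ. -/

/-- A normed division ring with an involution for which left and right multiplications by `a`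
and `star a` are adjoint with respect to a real inner product inducing the norm. -/
class AdjointMul (F : Type) [NormedDivisionRing F] [StarRing F] [InnerProductSpace ℝ F] :
    Prop where
  inner_mul_left : ∀ a b c : F, inner ℝ (a * b) c = inner ℝ b (star a * c)
  inner_mul_right : ∀ a b c : F, inner ℝ (b * a) c = inner ℝ b (c * star a)

instance : AdjointMul ℝ where
  inner_mul_left a b c := by simp; ring
  inner_mul_right a b c := by simp; ring

instance : AdjointMul ℂ where
  inner_mul_left a b c := by simp [Complex.inner]; ring
  inner_mul_right a b c := by simp [Complex.inner]; ring

instance : AdjointMul ℍ[ℝ] where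
  inner_mul_left a b c := by simp [Quaternion.inner_def]; ring
  inner_mul_right a b c := by simp [Quaternion.inner_def]; ring

/-! ### Sufficiency: embedding the lines as unit vectors -/

section Feature

variable {F : Type} [NormedDivisionRing F] [StarRing F] [NormedStarGroup F]
  [InnerProductSpace ℝ F] [AdjointMul F] {n : ℕ}

/-- The matrix of the rank one operator attached to a vector. -/
def rankOne (x : Fin (n + 1) → F) : PiLp 2 (fun _ : Fin (n + 1) × Fin (n + 1) => F) :=
  -- In this order a left scalar `a` on `x` enters as the inner factor `star a * a`, which suits
  -- left lines over ℍ.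
  WithLp.toLp 2 fun ab => star (x ab.2) * x ab.1

omit [NormedStarGroup F] in
theorem inner_rankOne (x y : Fin (n + 1) → F) :
    inner ℝ (rankOne x) (rankOne y) = ‖herm x y‖ ^ 2 := by
  rw [← real_inner_self_eq_norm_sq, PiLp.inner_apply, herm, inner_sum, Fintype.sum_prod_type,
    Finset.sum_comm]
  refine Finset.sum_congr rfl fun b _ => ?_
  rw [sum_inner]
  refine Finset.sum_congr rfl fun a _ => ?_
  simp only [rankOne]
  rw [AdjointMul.inner_mul_left, star_star, AdjointMul.inner_mul_right, star_star, mul_assoc]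

omit [StarRing F] [NormedStarGroup F] [InnerProductSpace ℝ F] [AdjointMul F] in
theorem enorm2_pos {x : Fin (n + 1) → F} (hx : x ≠ 0) : 0 < enorm2 x := by
  obtain ⟨i, hi⟩ := Function.ne_iff.1 hx
  have hi : x i ≠ 0 := hi
  refine Real.sqrt_pos.2 (Finset.sum_pos' (fun _ _ => by positivity) ⟨i, Finset.mem_univ i, ?_⟩)
  positivity

omit [InnerProductSpace ℝ F] [AdjointMul F] in
theorem norm_rankOne (x : Fin (n + 1) → F) : ‖rankOne x‖ = enorm2 x ^ 2 := by
  have h : ‖rankOne x‖ ^ 2 = (enorm2 x ^ 2) ^ 2 := by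
    rw [PiLp.norm_sq_eq_of_L2, enorm2, Real.sq_sqrt (by positivity), Fintype.sum_prod_type, sq,
      Finset.sum_mul_sum]
    simp [rankOne, mul_pow, mul_comm]
  exact (pow_left_inj₀ (norm_nonneg _) (by positivity) two_ne_zero).1 h

/-- The unit vector attached to a line, the normalized matrix of the projection onto it. -/
noncomputable def feature (p : ProjSpace F n) : PiLp 2 (fun _ : Fin (n + 1) × Fin (n + 1) => F) :=
  (enorm2 p.rep ^ 2)⁻¹ • rankOne p.rep

omit [AdjointMul F] in
theorem norm_feature (p : ProjSpace F n) : ‖feature p‖ = 1 := by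
  have := enorm2_pos p.rep_nonzero
  rw [feature, norm_smul, norm_rankOne, Real.norm_of_nonneg (by positivity)]
  exact inv_mul_cancel₀ (by positivity)

omit [NormedStarGroup F] in
theorem inner_feature (p q : ProjSpace F n) :
    inner ℝ (feature p) (feature q) = lineCos p q ^ 2 := by
  rw [feature, feature, real_inner_smul_left, real_inner_smul_right, inner_rankOne, lineCos,
    div_pow, mul_pow, div_eq_mul_inv, mul_inv]
  ring

omit [NormedStarGroup F] in
theorem feature_injective : Function.Injective (feature : ProjSpace F n → _) := by
  intro p q h
  obtain ⟨b, hb⟩ := Function.ne_iff.1 p.rep_nonzero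
  have hb : p.rep b ≠ 0 := hb
  have hb' : star (p.rep b) ≠ 0 := by simpa using hb
  have hp := enorm2_pos p.rep_nonzero
  rw [← p.mk_rep, ← q.mk_rep, Projectivization.mk_eq_mk_iff']
  -- Obtained by solving the `(a, b)` entries of `feature p = feature q`, with `b` fixed, for `p.rep
  -- a`.
  refine ⟨(star (p.rep b))⁻¹ * (enorm2 p.rep ^ 2 • (enorm2 q.rep ^ 2)⁻¹ • star (q.rep b)), ?_⟩
  funext a
  have h1 : (enorm2 p.rep ^ 2)⁻¹ • (star (p.rep b) * p.rep a)
      = (enorm2 q.rep ^ 2)⁻¹ • (star (q.rep b) * q.rep a) :=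
    congrArg (fun v => v (a, b)) h
  -- Real scalars pass through the product because right multiplication has an adjoint.
  have h2 (r : ℝ) (u v : F) : (r • u) * v = r • (u * v) := by
    refine ext_inner_right ℝ fun w => ?_
    rw [AdjointMul.inner_mul_right, real_inner_smul_left, real_inner_smul_left,
      AdjointMul.inner_mul_right]
  rw [Pi.smul_apply, smul_eq_mul, mul_assoc, h2, h2, ← h1,
    smul_inv_smul₀ (by positivity), inv_mul_cancel_left₀ hb']

theorem lineCos_sq_le_one (p q : ProjSpace F n) : lineCos p q ^ 2 ≤ 1 := by
  rw [← inner_feature]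
  simpa [norm_feature] using real_inner_le_norm (feature p) (feature q)

theorem lineCos_sq_eq_one_iff (p q : ProjSpace F n) : lineCos p q ^ 2 = 1 ↔ p = q := by
  rw [← inner_feature, inner_eq_one_iff_of_norm_eq_one (norm_feature p) (norm_feature q),
    feature_injective.eq_iff]

theorem cos_half_geoDist (p q : ProjSpace F n) :
    Real.cos (geoDist p q / 2) = 2 * lineCos p q ^ 2 - 1 := by
  have h := abs_le.1 ((sq_le_one_iff_abs_le_one _).1 (lineCos_sq_le_one p q))
  rw [geoDist, show 4 * Real.arccos (lineCos p q) / 2 = 2 * Real.arccos (lineCos p q) by ring,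
    Real.cos_two_mul, Real.cos_arccos h.1 h.2]

-- Schur product theorem, applied to Hadamard powers of the Gram matrix of the `feature` vectors.
omit [NormedStarGroup F] in
theorem sum_lineCos_pow_nonneg {m : ℕ} (x : Fin m → ProjSpace F n) (c : Fin m → ℝ) (k : ℕ) :
    0 ≤ ∑ i, ∑ j, c i * c j * (lineCos (x i) (x j) ^ 2) ^ k := by
  have hps : (Matrix.of fun i j => (lineCos (x i) (x j) ^ 2) ^ k).PosSemidef := by
    induction k with
    | zero =>
      have h := Matrix.posSemidef_gram ℝ (fun _ : Fin m => (1 : ℝ))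
      have h' : (Matrix.of fun i j => (lineCos (x i) (x j) ^ 2) ^ 0)
          = Matrix.gram ℝ (fun _ : Fin m => (1 : ℝ)) := by
        ext i j
        simp [Matrix.gram]
      rw [h']
      exact h
    | succ k ih =>
      have h := ih.hadamard (Matrix.posSemidef_gram ℝ fun i => feature (x i))
      have h' : (Matrix.of fun i j => (lineCos (x i) (x j) ^ 2) ^ (k + 1))
          = (Matrix.of fun i j => (lineCos (x i) (x j) ^ 2) ^ k).hadamard
            (Matrix.gram ℝ fun i => feature (x i)) := by
        ext i j
        simp [Matrix.gram, inner_feature, pow_succ]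
      rw [h']
      exact h
  refine (hps.dotProduct_mulVec_nonneg c).trans_eq ?_
  simp only [dotProduct, Matrix.mulVec, Finset.mul_sum, Matrix.of_apply, Pi.star_apply,
    star_trivial]
  exact Finset.sum_congr rfl fun i _ => Finset.sum_congr rfl fun j _ => by ring

theorem tendsto_sum_lineCos_pow {m : ℕ} {x : Fin m → ProjSpace F n} (hx : Function.Injective x)
    (c : Fin m → ℝ) :
    Tendsto (fun k : ℕ => ∑ i, ∑ j, c i * c j * (lineCos (x i) (x j) ^ 2) ^ k) atTop
      (𝓝 (∑ i, c i ^ 2)) := by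
  have h : ∑ i, c i ^ 2 = ∑ i, ∑ j, c i * c j * (if i = j then 1 else 0) := by simp [sq]
  rw [h]
  refine tendsto_finsetSum _ fun i _ => tendsto_finsetSum _ fun j _ => Tendsto.const_mul _ ?_
  split_ifs with hij
  · have h1 : lineCos (x i) (x j) ^ 2 = 1 := (lineCos_sq_eq_one_iff _ _).2 (congrArg x hij)
    rw [h1]
    exact tendsto_const_nhds.congr fun k => (one_pow k).symm
  · refine tendsto_pow_atTop_nhds_zero_of_lt_one (sq_nonneg _)
      ((lineCos_sq_le_one _ _).lt_of_ne fun h => hij (hx ((lineCos_sq_eq_one_iff _ _).1 h)))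

/-- A nonnegative power series with infinitely many nonzero coefficients is the isotropic part
of a strictly positive definite kernel. -/
theorem strictlyPosDef_kernel {f : Set.Icc (-1 : ℝ) 1 → ℝ} {a : ℕ → ℝ} (ha : ∀ k, 0 ≤ a k)
    (hf : ∀ t : Set.Icc (-1 : ℝ) 1, HasSum (fun k : ℕ => a k * ((1 + (t : ℝ)) / 2) ^ k) (f t))
    (hinf : ∃ᶠ k in atTop, 0 < a k) :
    StrictlyPosDef (kernel f : ProjSpace F n → ProjSpace F n → ℝ) := by
  intro m x hx c hc
  have hpos : 0 < ∑ i, c i ^ 2 := by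
    obtain ⟨i, hi⟩ := Function.ne_iff.1 hc
    have hi : c i ≠ 0 := hi
    exact Finset.sum_pos' (fun _ _ => by positivity) ⟨i, Finset.mem_univ i, by positivity⟩
  -- One strictly positive term suffices, as all others are nonnegative.
  obtain ⟨k, hak, hk⟩ :=
    (hinf.and_eventually ((tendsto_sum_lineCos_pow hx c).eventually_const_lt hpos)).exists
  have hsum : HasSum
      (fun k => a k * ∑ i, ∑ j, c i * c j * (lineCos (x i) (x j) ^ 2) ^ k)
      (∑ i, ∑ j, c i * c j * kernel f (x i) (x j)) := by
    simp only [Finset.mul_sum]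
    refine hasSum_sum fun i _ => hasSum_sum fun j _ => ?_
    have hterm := ((hf ⟨_, Real.cos_mem_Icc (geoDist (x i) (x j) / 2)⟩).mul_left (c i * c j))
    have heq : (fun k => a k * (c i * c j * (lineCos (x i) (x j) ^ 2) ^ k)) = fun k =>
        c i * c j * (a k * ((1 + Real.cos (geoDist (x i) (x j) / 2)) / 2) ^ k) := by
      funext k
      rw [cos_half_geoDist, show (1 + (2 * lineCos (x i) (x j) ^ 2 - 1)) / 2
        = lineCos (x i) (x j) ^ 2 by ring]
      ring
    rw [heq]
    exact hterm
  exact (mul_pos hak hk).trans_le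
    (le_hasSum hsum k fun l _ => mul_nonneg (ha l) (sum_lineCos_pow_nonneg x c l))

end Feature

/-! ### Necessity: polynomials give degenerate kernels -/

section Polynomial

open Polynomial

/-- Finitely many linear conditions: a nonzero combination of the evaluations at sufficiently
many points annihilates all polynomials of bounded degree. -/
theorem exists_ne_zero_sum_mul_eval_eq_zero {m d : ℕ} (h : d + 1 < m) (s : Fin m → ℝ) :
    ∃ c : Fin m → ℝ, c ≠ 0 ∧ ∀ p : ℝ[X], p.natDegree ≤ d → ∑ i, c i * p.eval (s i) = 0 := by
  let L := Matrix.mulVecLin (Matrix.of fun (r : Fin (d + 1)) (i : Fin m) => s i ^ (r : ℕ))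
  obtain ⟨c, hc, hc0⟩ := (Submodule.ne_bot_iff _).1
    (LinearMap.ker_ne_bot_of_finrank_lt (f := L) (by simpa using h))
  refine ⟨c, hc0, fun p hp => ?_⟩
  simp only [eval_eq_sum_range' (Nat.lt_succ_of_le hp), Finset.mul_sum]
  rw [Finset.sum_comm]
  refine Finset.sum_eq_zero fun r hr => ?_
  have h1 : ∑ i, s i ^ r * c i = 0 := congrFun (LinearMap.mem_ker.1 hc) ⟨r, Finset.mem_range.1 hr⟩
  rw [← mul_zero (p.coeff r), ← h1, Finset.mul_sum]
  exact Finset.sum_congr rfl fun i _ => by ring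

variable {F : Type} [NormedDivisionRing F] [StarRing F] [NormedStarGroup F]
  [InnerProductSpace ℝ F] {n : ℕ}

variable (F n) in
/-- The vector `(1, s, 0, …, 0)`. -/
def curveVec (s : ℕ) : Fin (n + 2) → F := Fin.cons 1 (Fin.cons (s : F) 0)

omit [StarRing F] [NormedStarGroup F] [InnerProductSpace ℝ F] in
theorem curveVec_ne_zero (s : ℕ) : curveVec F n s ≠ 0 :=
  fun h => one_ne_zero (α := F) (congrFun h 0)

omit [StarRing F] [NormedStarGroup F] in
theorem norm_natCast_eq (s : ℕ) : ‖(s : F)‖ = s := by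
  have : (s : F) = (s : ℝ) • (1 : F) := by rw [Nat.cast_smul_eq_nsmul, nsmul_one]
  simp [this, norm_smul]

omit [StarRing F] [NormedStarGroup F] in
theorem enorm2_curveVec_sq (s : ℕ) : enorm2 (curveVec F n s) ^ 2 = 1 + (s : ℝ) ^ 2 := by
  rw [enorm2, Real.sq_sqrt (by positivity), Fin.sum_univ_succ, Fin.sum_univ_succ]
  simp [curveVec, norm_natCast_eq]

omit [NormedStarGroup F] in
theorem norm_herm_curveVec (s t : ℕ) :
    ‖herm (curveVec F n s) (curveVec F n t)‖ = 1 + (s : ℝ) * t := by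
  have : herm (curveVec F n s) (curveVec F n t) = ((1 + s * t : ℕ) : F) := by
    rw [herm, Fin.sum_univ_succ, Fin.sum_univ_succ]
    simp [curveVec]
  rw [this, norm_natCast_eq]
  push_cast
  rfl

variable (F n) in
/-- The line spanned by `(1, s, 0, …, 0)`. -/
def curvePt (s : ℕ) : ProjSpace F (n + 1) := Projectivization.mk F _ (curveVec_ne_zero s)

omit [StarRing F] [NormedStarGroup F] in
theorem curvePt_injective : Function.Injective (curvePt F n) := by
  intro s t h
  obtain ⟨a, ha⟩ := (Projectivization.mk_eq_mk_iff' _ _ _ _ _).1 h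
  have h0 : a * 1 = 1 := congrFun ha 0
  have h1 : a * (t : F) = s := congrFun ha 1
  rw [mul_one] at h0
  rw [h0, one_mul] at h1
  have h2 := congrArg norm h1
  rw [norm_natCast_eq, norm_natCast_eq] at h2
  exact_mod_cast h2.symm

theorem lineCos_curvePt_sq (s t : ℕ) : lineCos (curvePt F n s) (curvePt F n t) ^ 2
    = (1 + (s : ℝ) * t) ^ 2 / ((1 + (s : ℝ) ^ 2) * (1 + (t : ℝ) ^ 2)) := by
  rw [curvePt, curvePt, lineCos_mk, div_pow, mul_pow, enorm2_curveVec_sq, enorm2_curveVec_sq,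
    norm_herm_curveVec]

variable [AdjointMul F]

/-- On the points `(1, i, 0, …)` the kernel is rational in `i`. Clearing denominators leaves, for
each `j`, a polynomial in `i` of degree at most `2d`, and these are all annihilated by one nonzero
combination of `2d + 2` evaluations. -/
theorem not_strictlyPosDef_of_isPoly {f : Set.Icc (-1 : ℝ) 1 → ℝ} (hf : IsPoly f) :
    ¬ StrictlyPosDef (kernel f : ProjSpace F (n + 1) → ProjSpace F (n + 1) → ℝ) := by
  obtain ⟨p, hp⟩ := hf
  intro hspd
  set d := p.natDegree
  obtain ⟨c, hc, hann⟩ := exists_ne_zero_sum_mul_eval_eq_zero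
    (d := 2 * d) (m := 2 * d + 2) (by omega) (fun i => ((i : ℕ) : ℝ))
  have hpos (i : ℕ) : 0 < 1 + (i : ℝ) ^ 2 := by positivity
  -- The weights absorb the denominators in both variables.
  let e : Fin (2 * d + 2) → ℝ := fun i => c i * (1 + (i : ℝ) ^ 2) ^ d
  have he : e ≠ 0 := by
    obtain ⟨i, hi⟩ := Function.ne_iff.1 hc
    exact Function.ne_iff.2 ⟨i, mul_ne_zero hi (pow_pos (hpos i) d).ne'⟩
  let N (j : ℕ) : ℝ[X] := 2 * (1 + C (j : ℝ) * X) ^ 2 - (1 + X ^ 2) * C (1 + (j : ℝ) ^ 2)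
  let D (j : ℕ) : ℝ[X] := (1 + X ^ 2) * C (1 + (j : ℝ) ^ 2)
  have hN (j : ℕ) : (N j).natDegree ≤ 2 := by dsimp only [N]; compute_degree
  have hD (j : ℕ) : (D j).natDegree ≤ 2 := by dsimp only [D]; compute_degree
  -- `R j` is `D ^ d * p(N / D)`, the homogenization of `p`.
  let R (j : ℕ) : ℝ[X] := ∑ k ∈ Finset.range (d + 1), C (p.coeff k) * (N j ^ k * D j ^ (d - k))
  have hR (j : ℕ) : (R j).natDegree ≤ 2 * d := by
    refine natDegree_sum_le_of_forall_le _ _ fun k hk => (natDegree_C_mul_le _ _).trans ?_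
    refine natDegree_mul_le.trans ?_
    have h1 := natDegree_pow_le_of_le k (hN j)
    have h2 := natDegree_pow_le_of_le (d - k) (hD j)
    have := Finset.mem_range.1 hk
    omega
  have hker (i j : ℕ) : (1 + (i : ℝ) ^ 2) ^ d * (1 + (j : ℝ) ^ 2) ^ d
      * kernel f (curvePt F n i) (curvePt F n j) = (R j).eval (i : ℝ) := by
    rw [kernel, hp]
    dsimp only
    rw [cos_half_geoDist, lineCos_curvePt_sq, eval_eq_sum_range, eval_finsetSum,
      Finset.mul_sum]
    refine Finset.sum_congr rfl fun k hk => ?_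
    have hi := (hpos i).ne'
    have hj := (hpos j).ne'
    obtain ⟨l, hl⟩ := Nat.exists_eq_add_of_le (Nat.lt_succ_iff.1 (Finset.mem_range.1 hk))
    have hq : 2 * ((1 + (i : ℝ) * j) ^ 2 / ((1 + (i : ℝ) ^ 2) * (1 + (j : ℝ) ^ 2))) - 1
        = (N j).eval (i : ℝ) / (D j).eval (i : ℝ) := by
      simp [N, D]
      field_simp
    have hDe : (D j).eval (i : ℝ) = (1 + (i : ℝ) ^ 2) * (1 + (j : ℝ) ^ 2) := by simp [D]
    have hD0 : (D j).eval (i : ℝ) ≠ 0 := hDe ▸ mul_ne_zero hi hj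
    rw [hq, ← mul_pow, ← hDe, show d - k = l by omega, hl]
    simp only [eval_mul, eval_C, eval_pow]
    rw [div_pow, pow_add]
    field_simp
  have hzero : ∑ i, ∑ j, e i * e j * kernel f (curvePt F n i) (curvePt F n j) = 0 := by
    rw [Finset.sum_comm]
    refine Finset.sum_eq_zero fun j _ => ?_
    rw [← mul_zero (c j), ← hann (R j) (hR j), Finset.mul_sum]
    refine Finset.sum_congr rfl fun i _ => ?_
    rw [← hker]
    ring
  exact (hspd _ (fun i => curvePt F n i) (curvePt_injective.comp Fin.val_injective) e he).ne' hzero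

end Polynomial

/-! ### Power series coefficients and Cauchy products -/

theorem frequently_coeff_pos {f : Set.Icc (-1 : ℝ) 1 → ℝ} {a : ℕ → ℝ} (ha : ∀ k, 0 ≤ a k)
    (hf : ∀ t : Set.Icc (-1 : ℝ) 1, HasSum (fun k : ℕ => a k * ((1 + (t : ℝ)) / 2) ^ k) (f t))
    (hpoly : ¬ IsPoly f) : ∃ᶠ k in atTop, 0 < a k := by
  -- `∃ᶠ` unfolds to a negation, so `h` says that eventually `aₖ` is not positive, hence zero: the
  -- series is a finite sum.
  refine fun h => hpoly ?_
  obtain ⟨N, hN⟩ := eventually_atTop.1 h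
  refine ⟨∑ k ∈ Finset.range N, Polynomial.C (a k) *
    (Polynomial.C (1 / 2) * (1 + Polynomial.X)) ^ k, fun t => (hf t).unique ?_⟩
  have hs : HasSum (fun k => a k * ((1 + (t : ℝ)) / 2) ^ k)
      (∑ k ∈ Finset.range N, a k * ((1 + (t : ℝ)) / 2) ^ k) :=
    hasSum_sum_of_ne_finset_zero fun k hk => by
      rw [le_antisymm (not_lt.1 (hN k (by simpa using hk))) (ha k), zero_mul]
  simpa [Polynomial.eval_finsetSum, div_eq_inv_mul] using hs

theorem IsPoly.mul {f g : Set.Icc (-1 : ℝ) 1 → ℝ} (hf : IsPoly f) (hg : IsPoly g) :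
    IsPoly (f * g) := by
  obtain ⟨p, hp⟩ := hf
  obtain ⟨q, hq⟩ := hg
  exact ⟨p * q, fun t => by simp [hp, hq]⟩

theorem hasSum_mul_antidiagonal {f g : Set.Icc (-1 : ℝ) 1 → ℝ} {a b : ℕ → ℝ}
    (hf : ∀ t : Set.Icc (-1 : ℝ) 1, HasSum (fun k : ℕ => a k * ((1 + (t : ℝ)) / 2) ^ k) (f t))
    (hg : ∀ t : Set.Icc (-1 : ℝ) 1, HasSum (fun k : ℕ => b k * ((1 + (t : ℝ)) / 2) ^ k) (g t))
    (t : Set.Icc (-1 : ℝ) 1) :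
    HasSum (fun k : ℕ => (∑ l ∈ Finset.HasAntidiagonal.antidiagonal k, a l.1 * b l.2) * ((1 + (t : ℝ)) / 2) ^ k)
      ((f * g) t) := by
  set u := (1 + (t : ℝ)) / 2
  have hfn : Summable fun k => ‖a k * u ^ k‖ := (hf t).summable.norm
  have hgn : Summable fun k => ‖b k * u ^ k‖ := (hg t).summable.norm
  have hs := (summable_norm_sum_mul_antidiagonal_of_summable_norm hfn hgn).of_norm.hasSum
  rw [← tsum_mul_tsum_eq_tsum_sum_antidiagonal_of_summable_norm hfn hgn, (hf t).tsum_eq,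
    (hg t).tsum_eq] at hs
  have heq : (fun k => (∑ l ∈ Finset.HasAntidiagonal.antidiagonal k, a l.1 * b l.2) * u ^ k)
      = fun k => ∑ l ∈ Finset.HasAntidiagonal.antidiagonal k,
        a l.1 * u ^ l.1 * (b l.2 * u ^ l.2) := by
    funext k
    rw [Finset.sum_mul]
    refine Finset.sum_congr rfl fun l hl => ?_
    rw [← Finset.HasAntidiagonal.mem_antidiagonal.1 hl, pow_add]
    ring
  rw [heq]
  exact hs

theorem IsPD.mul {f g : Set.Icc (-1 : ℝ) 1 → ℝ} (hf : IsPD f) (hg : IsPD g) : IsPD (f * g) := by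
  obtain ⟨a, ha, hfa⟩ := hf
  obtain ⟨b, hb, hgb⟩ := hg
  exact ⟨_, fun k => Finset.sum_nonneg fun l _ => mul_nonneg (ha _) (hb _),
    hasSum_mul_antidiagonal hfa hgb⟩

/-! ### The equivalences -/

section Main

variable {F : Type} [NormedDivisionRing F] [StarRing F] [NormedStarGroup F]
  [InnerProductSpace ℝ F] [AdjointMul F] {f g : Set.Icc (-1 : ℝ) 1 → ℝ}

theorem IsSPD.not_isPoly (h : IsSPD F f) : ¬ IsPoly f :=
  -- The lemma concerns dimension `n + 1`, so `n = 1` is the plane.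
  fun hp => not_strictlyPosDef_of_isPoly (n := 1) hp (h.2 2 le_rfl)

theorem IsPD.isSPD (hf : IsPD f) (hp : ¬ IsPoly f) : IsSPD F f := by
  obtain ⟨a, ha, hfa⟩ := hf
  exact ⟨⟨a, ha, hfa⟩, fun n _ => strictlyPosDef_kernel ha hfa (frequently_coeff_pos ha hfa hp)⟩

theorem IsPD.isSPD_mul (hf : IsPD f) (hg : IsPD g) (hp : ¬ IsPoly f) (hg0 : g ≠ 0) :
    IsSPD F (f * g) := by
  refine ⟨hf.mul hg, fun n _ => ?_⟩
  obtain ⟨a, ha, hfa⟩ := hf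
  obtain ⟨b, hb, hgb⟩ := hg
  obtain ⟨j, hj⟩ : ∃ j, b j ≠ 0 := by
    by_contra! h
    exact hg0 (funext fun t => (hgb t).unique (by simp [h]))
  refine strictlyPosDef_kernel
    (fun k => Finset.sum_nonneg fun l _ => mul_nonneg (ha _) (hb _))
    (hasSum_mul_antidiagonal hfa hgb) ?_
  -- With `b j > 0` fixed, each `a k > 0` makes the coefficient of index `k + j` positive.
  refine (tendsto_add_atTop_nat j).frequently ((frequently_coeff_pos ha hfa hp).mono fun k hk => ?_)
  exact Finset.sum_pos' (fun l _ => mul_nonneg (ha _) (hb _))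
    ⟨(k, j), Finset.HasAntidiagonal.mem_antidiagonal.2 rfl, mul_pos hk ((hb j).lt_of_ne' hj)⟩

theorem isSPD_mul_tfae (hf : IsPD f) (hg : IsPD g) (hf0 : f ≠ 0) (hg0 : g ≠ 0) :
    [IsSPD F (f * g), IsSPD F f ∨ IsSPD F g, ¬ IsPoly f ∨ ¬ IsPoly g].TFAE := by
  tfae_have 1 → 3 := fun h => not_and_or.1 fun hp => h.not_isPoly (hp.1.mul hp.2)
  tfae_have 2 → 3 := Or.imp IsSPD.not_isPoly IsSPD.not_isPoly
  tfae_have 3 → 2 := Or.imp hf.isSPD hg.isSPD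
  tfae_have 3 → 1 := by
    rintro (h | h)
    · exact hf.isSPD_mul hg h hg0
    · rw [mul_comm]
      exact hg.isSPD_mul hf h hf0
  tfae_finish

end Main

end PInfty

theorem theorem3p3 (f g : Set.Icc (-1 : ℝ) 1 → ℝ) (hf : PInfty.IsPD f) (hg : PInfty.IsPD g)
    (hf0 : f ≠ 0) (hg0 : g ≠ 0) :
    [PInfty.IsSPD ℝ (f * g), PInfty.IsSPD ℝ f ∨ PInfty.IsSPD ℝ g,
      ¬ PInfty.IsPoly f ∨ ¬ PInfty.IsPoly g].TFAE ∧
    [PInfty.IsSPD ℂ (f * g), PInfty.IsSPD ℂ f ∨ PInfty.IsSPD ℂ g,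
      ¬ PInfty.IsPoly f ∨ ¬ PInfty.IsPoly g].TFAE ∧
    [PInfty.IsSPD ℍ[ℝ] (f * g), PInfty.IsSPD ℍ[ℝ] f ∨ PInfty.IsSPD ℍ[ℝ] g,
      ¬ PInfty.IsPoly f ∨ ¬ PInfty.IsPoly g].TFAE :=
  ⟨PInfty.isSPD_mul_tfae hf hg hf0 hg0, PInfty.isSPD_mul_tfae hf hg hf0 hg0,
    PInfty.isSPD_mul_tfae hf hg hf0 hg0⟩
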